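/- \textbf{Theorem.} Let $d\ge 2$ and let $X_1,X_2,\dots$ be random vectors in $\mathbb R^d$ on a probability space, with $\mathcal F_t=\sigma(X_1,\dots,X_t)$ ($\mathcal F_0$ trivial). Assume that they are integrable with constant conditional mean, $\mathbb E[X_t\mid\mathcal F_{t-1}]=\mu\in\mathbb R^d$ almost surely for all $t\ge 1$. For a function $\psi:[0,\lambda_{\max})\to\mathbb R$ with $\lambda_{\max}\in(0,\infty]$, call $(X_t)$ \emph{sub-$\psi$} if for all $t\ge 1$, all $\lambda\in[0,\lambda_{\max})$ and all $v\in\mathbb R^d$ with $\|v\|=1$ (Euclidean norm), $$\mathbb E\big[e^{\lambda\langle v,X_t-\mu\rangle}\,\big|\,\mathcal F_{t-1}\big]\le e^{\psi(\lambda)}\quad\text{almost surely.}$$ (i) If $(X_t)$ is sub-$\psi$, then for every deterministic sequence $(\lambda_t)_{t\ge 1}$ in $[0,\lambda_{\max})$ and every $\alpha\in(0,1)$, with probability at least $1-\alpha$, simultaneously for all $t\ge 1$ with $\sum_{i\le t}\lambda_i>0$, $$\left\|\frac{\sum_{i\le t}\lambda_iX_i}{\sum_{i\le t}\lambda_i}-\mu\right\|\le\frac{\sqrt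 d\,\sum_{i\le t}\psi(\lambda_i)+2\sqrt d+\sqrt d\,\log\frac1\alpha}{\frac23\sum_{i\le t}\lambda_i}.$$ (ii) The following classes are instances. Write $m_t(u)=\mathbb E[e^{\langle u,X_t-\mu\rangle}\mid\mathcal F_{t-1}]$. \begin{itemize} \item Conditionally $\sigma$-sub-Gaussian ($m_t(u)\le e^{\sigma^2\|u\|^2/2}$ a.s.\ for all $t\ge1$, $u\in\mathbb R^d$) is the same as sub-$\psi$ with $\psi(\lambda)=\lambda^2\sigma^2/2$ and $\lambda_{\max}=\infty$. \item Conditionally $(\sigma^2,\lambda_{\max})$-sub-exponential (the same bound for all $\|u\|<\lambda_{\max}$) is the same as sub-$\psi$ with $\psi(\lambda)=\lambda^2\sigma^2/2$ on $[0,\lambda_{\max})$. \item Conditionally $b$-sub-Gamma with $b>0$ ($m_t(u)\le \exp\big(\frac{\|u\|^2}{2(1-b\|u\|)}\big)$ a.s.\ for all $t\ge1$ and $\|u\|<1/b$) is the same as sub-$\psi$ with $\psi(\lambda)=\frac{\lambda^2}{2(1-b\lambda)}$ on $[0,1/b)$. \end{itemize} -/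

import Mathlib

open MeasureTheory

/-- The σ-field `ℱ_t = σ(X₁, …, X_t)` generated by the first `t` observations
(observations are indexed from `1`; `ℱ_0` is trivial). -/
abbrev obsSigma {Ω : Type*} {d : ℕ} (X : ℕ → Ω → EuclideanSpace ℝ (Fin d)) (t : ℕ) :
    MeasurableSpace Ω :=
  ⨆ i ∈ Finset.Icc 1 t, MeasurableSpace.comap (X i) inferInstance

/-- Constant conditional mean: `E[X_t | ℱ_{t-1}] = μ` almost surely, for all `t ≥ 1`. -/
def HasConstCondMean {Ω : Type*} [MeasurableSpace Ω] {d : ℕ} (P : Measure Ω)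
    (X : ℕ → Ω → EuclideanSpace ℝ (Fin d)) (μ : EuclideanSpace ℝ (Fin d)) : Prop :=
  ∀ t : ℕ, 1 ≤ t →
    Integrable (X t) P ∧ P[X t | obsSigma X (t - 1)] =ᵐ[P] fun _ => μ

/-- The sub-`ψ` condition on `[0, lmax)`, `lmax ∈ (0, ∞]`: for every unit vector `v` and every
`l ∈ [0, lmax)`, `E[exp(l ⟨v, X_t - μ⟩) | ℱ_{t-1}] ≤ exp(ψ(l))` almost surely, for all `t ≥ 1`.
The values of `ψ` outside `[0, lmax)` play no role. -/
def IsSubPsi {Ω : Type*} [MeasurableSpace Ω] {d : ℕ} (P : Measure Ω)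
    (X : ℕ → Ω → EuclideanSpace ℝ (Fin d)) (μ : EuclideanSpace ℝ (Fin d))
    (ψ : ℝ → ℝ) (lmax : EReal) : Prop :=
  ∀ t : ℕ, 1 ≤ t → ∀ l : ℝ, 0 ≤ l → (l : EReal) < lmax →
    ∀ v : EuclideanSpace ℝ (Fin d), ‖v‖ = 1 →
      Integrable (fun ω => Real.exp (l * inner ℝ v (X t ω - μ))) P ∧
      P[fun ω => Real.exp (l * inner ℝ v (X t ω - μ)) | obsSigma X (t - 1)]
        ≤ᵐ[P] fun _ => Real.exp (ψ l)

/-- Conditionally `σ`-sub-Gaussian random vectors. -/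
def IsCondSubGaussian {Ω : Type*} [MeasurableSpace Ω] {d : ℕ} (P : Measure Ω)
    (X : ℕ → Ω → EuclideanSpace ℝ (Fin d)) (μ : EuclideanSpace ℝ (Fin d)) (σ : ℝ) : Prop :=
  ∀ t : ℕ, 1 ≤ t → ∀ u : EuclideanSpace ℝ (Fin d),
    Integrable (fun ω => Real.exp (inner ℝ u (X t ω - μ))) P ∧
    P[fun ω => Real.exp (inner ℝ u (X t ω - μ)) | obsSigma X (t - 1)]
      ≤ᵐ[P] fun _ => Real.exp (‖u‖ ^ 2 * σ ^ 2 / 2)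

/-- Conditionally `(σ², lmax)`-sub-exponential random vectors: the sub-Gaussian bound on the
conditional moment generating function, in the ball of radius `lmax` only. -/
def IsCondSubExponential {Ω : Type*} [MeasurableSpace Ω] {d : ℕ} (P : Measure Ω)
    (X : ℕ → Ω → EuclideanSpace ℝ (Fin d)) (μ : EuclideanSpace ℝ (Fin d))
    (σ : ℝ) (lmax : EReal) : Prop :=
  ∀ t : ℕ, 1 ≤ t → ∀ u : EuclideanSpace ℝ (Fin d), (‖u‖ : EReal) < lmax →
    Integrable (fun ω => Real.exp (inner ℝ u (X t ω - μ))) P ∧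
    P[fun ω => Real.exp (inner ℝ u (X t ω - μ)) | obsSigma X (t - 1)]
      ≤ᵐ[P] fun _ => Real.exp (‖u‖ ^ 2 * σ ^ 2 / 2)

/-- Conditionally `b`-sub-Gamma random vectors, `b > 0`. -/
def IsCondSubGamma {Ω : Type*} [MeasurableSpace Ω] {d : ℕ} (P : Measure Ω)
    (X : ℕ → Ω → EuclideanSpace ℝ (Fin d)) (μ : EuclideanSpace ℝ (Fin d)) (b : ℝ) : Prop :=
  ∀ t : ℕ, 1 ≤ t → ∀ u : EuclideanSpace ℝ (Fin d), ‖u‖ < 1 / b →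
    Integrable (fun ω => Real.exp (inner ℝ u (X t ω - μ))) P ∧
    P[fun ω => Real.exp (inner ℝ u (X t ω - μ)) | obsSigma X (t - 1)]
      ≤ᵐ[P] fun _ => Real.exp (‖u‖ ^ 2 / (2 * (1 - b * ‖u‖)))

/-! The norm is controlled through only `2 * d` directions, the signed coordinate vectors. Jensen's
inequality, applied to each coefficient of the power series of `cosh`, bounds `exp (‖x‖ / √d)` by
twice the average of `cosh (x i)`, that is, by the sum over these directions of `exp ⟨v, x⟩`,
divided by `d`. For a unit vector `v`, the sub-`ψ` condition makes `exp (⟨v, S_t⟩ - ∑ ψ (lam i))` a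
nonnegative supermartingale started at `1`, where `S_t = ∑ lam i • (X i - μ)`. Ville's inequality
for the sum of the `2 * d` processes, at level `2 * d / α`, gives `‖S_t‖ ≤ √d (∑ ψ (lam i) + log 2 +
log (1 / α))` for all `t` at once. This is sharper than required. Part (ii) is the polar
decomposition `u = ‖u‖ • v`. -/

/-! ### Convexity: from coordinates to the Euclidean norm -/

theorem Real.cosh_sqrt_sum_sq_div_card_le {ι : Type*} [Fintype ι] [Nonempty ι] (a : ι → ℝ) :
    Real.cosh (Real.sqrt ((∑ i, a i ^ 2) / Fintype.card ι)) ≤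
      (∑ i, Real.cosh (a i)) / Fintype.card ι := by
  have hd : (0 : ℝ) < Fintype.card ι := by exact_mod_cast Fintype.card_pos
  have hR : HasSum (fun n : ℕ ↦ (∑ i, a i ^ (2 * n) / ((2 * n).factorial : ℝ)) / Fintype.card ι)
      ((∑ i, Real.cosh (a i)) / Fintype.card ι) :=
    (hasSum_sum fun i _ ↦ Real.hasSum_cosh (a i)).div_const _
  -- Only even powers occur, so the square root disappears and the `n`-th terms compare by convexity
  -- of `y ↦ y ^ n` at the points `a i ^ 2 ≥ 0`.
  refine hasSum_le (fun n ↦ ?_) (Real.hasSum_cosh _) hR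
  have hjensen := Real.pow_arith_mean_le_arith_mean_pow Finset.univ
    (fun _ : ι ↦ ((Fintype.card ι : ℝ))⁻¹) (fun i ↦ a i ^ 2) (fun _ _ ↦ by positivity)
    (by simp [hd.ne']) (fun _ _ ↦ by positivity) n
  rw [pow_mul, Real.sq_sqrt (by positivity), ← Finset.sum_div, div_right_comm]
  gcongr
  calc ((∑ i, a i ^ 2) / Fintype.card ι) ^ n
      = (∑ i, ((Fintype.card ι : ℝ))⁻¹ * a i ^ 2) ^ n := by
        rw [← Finset.mul_sum, div_eq_inv_mul]
    _ ≤ ∑ i, ((Fintype.card ι : ℝ))⁻¹ * (a i ^ 2) ^ n := hjensen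
    _ = (∑ i, a i ^ (2 * n)) / Fintype.card ι := by
        simp_rw [← Finset.mul_sum, div_eq_inv_mul, pow_mul]

/-- The scaled Euclidean norm is controlled by the average of `cosh` over the coordinates. -/
theorem EuclideanSpace.exp_norm_div_sqrt_le {d : ℕ} (hd : 0 < d) (x : EuclideanSpace ℝ (Fin d)) :
    Real.exp (‖x‖ / Real.sqrt d) ≤ 2 * ((∑ i, Real.cosh (x i)) / d) := by
  have : Nonempty (Fin d) := ⟨⟨0, hd⟩⟩
  have h := Real.cosh_sqrt_sum_sq_div_card_le (fun i ↦ x i)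
  rw [Fintype.card_fin] at h
  have hx : Real.sqrt ((∑ i, x i ^ 2) / d) = ‖x‖ / Real.sqrt d := by
    rw [EuclideanSpace.norm_eq, Real.sqrt_div' _ (Nat.cast_nonneg d)]
    simp
  rw [hx, Real.cosh_eq] at h
  linarith [Real.exp_pos (-(‖x‖ / Real.sqrt d))]

/-! ### Nonnegative supermartingales and Ville's inequality -/

/-- The pull-out property presupposes an integrable product. Truncating `f` makes it available; the
resulting bound does not depend on the truncation, and monotone convergence removes it. -/
theorem MeasureTheory.Integrable.mul_of_condExp_le_const {Ω : Type*} {m m0 : MeasurableSpace Ω}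
    {P : Measure Ω} [IsFiniteMeasure P] (hm : m ≤ m0) {f g : Ω → ℝ} {C : ℝ}
    (hf : StronglyMeasurable[m] f) (hf0 : 0 ≤ f) (hfi : Integrable f P)
    (hg0 : 0 ≤ g) (hgi : Integrable g P) (hgC : P[g | m] ≤ᵐ[P] fun _ ↦ C) :
    Integrable (f * g) P := by
  let F : ℕ → Ω → ℝ := fun n ω ↦ min (f ω) n
  have hF0 (n : ℕ) (ω : Ω) : 0 ≤ F n ω := le_min (hf0 ω) (Nat.cast_nonneg n)
  have hFm (n : ℕ) : StronglyMeasurable[m] (F n) :=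
    (continuous_id.min continuous_const).comp_stronglyMeasurable hf
  have hFb (n : ℕ) (ω : Ω) : ‖F n ω‖ ≤ n := by
    rw [Real.norm_of_nonneg (hF0 n ω)]
    exact min_le_right _ _
  have hFg (n : ℕ) : Integrable (F n * g) P :=
    hgi.bdd_mul ((hFm n).mono hm).aestronglyMeasurable (ae_of_all _ (hFb n))
  have hgE : 0 ≤ᵐ[P] P[g | m] := condExp_nonneg (ae_of_all _ hg0)
  have hbound (n : ℕ) : ∫ ω, (F n * g) ω ∂P ≤ ∫ ω, f ω * C ∂P := by
    rw [← integral_condExp hm]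
    refine integral_mono_ae integrable_condExp (hfi.mul_const C) ?_
    filter_upwards [condExp_mul_of_stronglyMeasurable_left (hFm n) (hFg n) hgi, hgC, hgE]
      with ω h1 h2 h3
    rw [h1]
    exact mul_le_mul (min_le_left _ _) h2 h3 (hf0 ω)
  have hlim : Filter.Tendsto (fun n ↦ ∫⁻ ω, ENNReal.ofReal ((F n * g) ω) ∂P) Filter.atTop
      (nhds (∫⁻ ω, ENNReal.ofReal ((f * g) ω) ∂P)) := by
    refine lintegral_tendsto_of_tendsto_of_monotone
      (fun n ↦ (hFg n).aestronglyMeasurable.aemeasurable.ennreal_ofReal)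
      (ae_of_all _ fun ω i j hij ↦ ?_) (ae_of_all _ fun ω ↦ ?_)
    · refine ENNReal.ofReal_le_ofReal (mul_le_mul_of_nonneg_right ?_ (hg0 ω))
      exact min_le_min le_rfl (Nat.cast_le.2 hij)
    · refine tendsto_const_nhds.congr' ?_
      obtain ⟨N, hN⟩ := exists_nat_ge (f ω)
      filter_upwards [Filter.eventually_ge_atTop N] with n hn
      simp [F, min_eq_left (hN.trans (Nat.cast_le.2 hn))]
  refine ⟨(hf.mono hm).aestronglyMeasurable.mul hgi.aestronglyMeasurable, ?_⟩
  rw [hasFiniteIntegral_iff_ofReal (f := f * g) (ae_of_all _ fun ω ↦ mul_nonneg (hf0 ω) (hg0 ω))]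
  refine lt_of_le_of_lt (le_of_tendsto' hlim fun n ↦ ?_)
    (ENNReal.ofReal_lt_top (r := ∫ ω, f ω * C ∂P))
  rw [← ofReal_integral_eq_lintegral_ofReal (hFg n)
    (ae_of_all _ fun ω ↦ mul_nonneg (hF0 n ω) (hg0 ω))]
  exact ENNReal.ofReal_le_ofReal (hbound n)

/-- **Ville's inequality** over a finite horizon. -/
theorem MeasureTheory.Supermartingale.mul_measureReal_exists_le_le {Ω : Type*}
    {m0 : MeasurableSpace Ω} {P : Measure Ω} [IsFiniteMeasure P] {ℱ : Filtration ℕ m0}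
    {M : ℕ → Ω → ℝ} (hM : Supermartingale M ℱ P) (hM0 : ∀ n ω, 0 ≤ M n ω) {c : ℝ} (hc : 0 ≤ c)
    (N : ℕ) : c * P.real {ω | ∃ n ≤ N, c ≤ M n ω} ≤ ∫ ω, M 0 ω ∂P := by
  -- If level `c` is not reached by time `N`, this time equals `N`; it is thus bounded, and optional
  -- stopping applies.
  let τ : Ω → ℕ∞ := fun ω ↦ (hittingBtwn M (Set.Ici c) 0 N ω : ℕ)
  have hτ : IsStoppingTime ℱ τ :=
    hM.stronglyAdapted.adapted.isStoppingTime_hittingBtwn measurableSet_Ici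
  have hτN : ∀ ω, τ ω ≤ N := fun ω ↦ Nat.cast_le.2 (hittingBtwn_le ω)
  have hint : Integrable (stoppedValue M τ) P := integrable_stoppedValue ℕ hτ hM.integrable hτN
  have hstopped : ∫ ω, stoppedValue M τ ω ∂P ≤ ∫ ω, M 0 ω ∂P := by
    have h := hM.neg.expected_stoppedValue_mono (isStoppingTime_const ℱ 0) hτ
      (fun _ ↦ zero_le) hτN
    have h1 : ∫ ω, -M 0 ω ∂P ≤ ∫ ω, -stoppedValue M τ ω ∂P := h
    rw [integral_neg, integral_neg] at h1
    linarith
  refine le_trans ?_ hstopped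
  refine le_trans ?_ (mul_meas_ge_le_integral_of_nonneg (ae_of_all _ fun ω ↦ hM0 _ ω) hint c)
  gcongr
  · exact measure_ne_top _ _
  · rintro ⟨n, hn, hcn⟩
    exact stoppedValue_hittingBtwn_mem (s := Set.Ici c) ⟨n, ⟨Nat.zero_le n, hn⟩, hcn⟩

/-- **Ville's inequality** for nonnegative supermartingales in discrete time. -/
theorem MeasureTheory.Supermartingale.ville_inequality {Ω : Type*}
    {m0 : MeasurableSpace Ω} {P : Measure Ω} [IsFiniteMeasure P] {ℱ : Filtration ℕ m0}
    {M : ℕ → Ω → ℝ} (hM : Supermartingale M ℱ P) (hM0 : ∀ n ω, 0 ≤ M n ω) {c : ℝ} (hc : 0 ≤ c) :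
    c * P.real {ω | ∃ n, c ≤ M n ω} ≤ ∫ ω, M 0 ω ∂P := by
  have hU : {ω | ∃ n, c ≤ M n ω} = ⋃ N : ℕ, {ω | ∃ n ≤ N, c ≤ M n ω} := by
    ext ω
    simp only [Set.mem_ofPred_eq, Set.mem_iUnion]
    exact ⟨fun ⟨n, hn⟩ ↦ ⟨n, n, le_rfl, hn⟩, fun ⟨_, n, _, hn⟩ ↦ ⟨n, hn⟩⟩
  have hmono : Monotone fun N : ℕ ↦ {ω | ∃ n ≤ N, c ≤ M n ω} :=
    fun _ _ hij _ ⟨n, hn, h⟩ ↦ ⟨n, hn.trans hij, h⟩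
  have hlim := (ENNReal.tendsto_toReal (measure_ne_top P _)).comp
    (tendsto_measure_iUnion_atTop (μ := P) hmono)
  rw [hU]
  exact le_of_tendsto' (hlim.const_mul c) fun N ↦ hM.mul_measureReal_exists_le_le hM0 hc N

theorem MeasureTheory.Supermartingale.finset_sum {Ω ι : Type*} {m0 : MeasurableSpace Ω}
    {P : Measure Ω} {ℱ : Filtration ℕ m0} (s : Finset ι) {M : ι → ℕ → Ω → ℝ}
    (hM : ∀ i ∈ s, Supermartingale (M i) ℱ P) : Supermartingale (∑ i ∈ s, M i) ℱ P :=
  Finset.sum_induction M (Supermartingale · ℱ P) (fun _ _ ↦ Supermartingale.add)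
    (martingale_zero ℝ ℱ P).supermartingale hM

/-- The filtration generated by the observations `X₁, X₂, …`. -/
def obsFiltration {Ω : Type*} [m0 : MeasurableSpace Ω] {d : ℕ}
    (X : ℕ → Ω → EuclideanSpace ℝ (Fin d)) (hX : ∀ t : ℕ, 1 ≤ t → Measurable (X t)) :
    Filtration ℕ m0 where
  seq := obsSigma X
  mono' _ _ hst := biSup_mono fun _ hi ↦ Finset.Icc_subset_Icc_right hst hi
  le' _ := iSup₂_le fun i hi ↦ (hX i (Finset.mem_Icc.1 hi).1).comap_le

theorem measurable_obsSigma {Ω : Type*} {d : ℕ} (X : ℕ → Ω → EuclideanSpace ℝ (Fin d))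
    {i t : ℕ} (hi : 1 ≤ i) (hit : i ≤ t) : Measurable[obsSigma X t] (X i) :=
  measurable_iff_comap_le.2
    (le_iSup₂_of_le (f := fun j (_ : j ∈ Finset.Icc 1 t) ↦
      MeasurableSpace.comap (X j) inferInstance) i (Finset.mem_Icc.2 ⟨hi, hit⟩) le_rfl)

/-- The exponential process in direction `v`. -/
noncomputable def expProcess {Ω : Type*} {d : ℕ} (X : ℕ → Ω → EuclideanSpace ℝ (Fin d))
    (μ : EuclideanSpace ℝ (Fin d)) (ψ : ℝ → ℝ) (lam : ℕ → ℝ) (v : EuclideanSpace ℝ (Fin d))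
    (n : ℕ) (ω : Ω) : ℝ :=
  Real.exp (inner ℝ v (∑ i ∈ Finset.Icc 1 n, lam i • (X i ω - μ))
    - ∑ i ∈ Finset.Icc 1 n, ψ (lam i))

theorem expProcess_succ {Ω : Type*} {d : ℕ} (X : ℕ → Ω → EuclideanSpace ℝ (Fin d))
    (μ : EuclideanSpace ℝ (Fin d)) (ψ : ℝ → ℝ) (lam : ℕ → ℝ) (v : EuclideanSpace ℝ (Fin d))
    (n : ℕ) : expProcess X μ ψ lam v (n + 1) =
      (Real.exp (-ψ (lam (n + 1))) • expProcess X μ ψ lam v n) *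
        fun ω ↦ Real.exp (lam (n + 1) * inner ℝ v (X (n + 1) ω - μ)) := by
  ext ω
  simp only [expProcess, Pi.mul_apply, Pi.smul_apply, smul_eq_mul, ← Real.exp_add,
    Finset.sum_Icc_succ_top (Nat.le_add_left 1 n), inner_add_right, inner_smul_right]
  congr 1
  ring

/-- Each step multiplies by a factor whose conditional mean is at most `1`. Integrability comes
first, by induction, since neither factor need be bounded. -/
theorem supermartingale_expProcess {Ω : Type*} [MeasurableSpace Ω] {P : Measure Ω}
    [IsProbabilityMeasure P] {d : ℕ} {X : ℕ → Ω → EuclideanSpace ℝ (Fin d)}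
    (hX : ∀ t : ℕ, 1 ≤ t → Measurable (X t)) {μ : EuclideanSpace ℝ (Fin d)} {ψ : ℝ → ℝ}
    {lmax : EReal} (h : IsSubPsi P X μ ψ lmax) {lam : ℕ → ℝ}
    (hlam : ∀ t : ℕ, 1 ≤ t → 0 ≤ lam t ∧ (lam t : EReal) < lmax)
    {v : EuclideanSpace ℝ (Fin d)} (hv : ‖v‖ = 1) :
    Supermartingale (expProcess X μ ψ lam v) (obsFiltration X hX) P := by
  have hadp : StronglyAdapted (obsFiltration X hX) (expProcess X μ ψ lam v) := by
    intro n
    have hS : StronglyMeasurable[obsSigma X n]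
        fun ω ↦ ∑ i ∈ Finset.Icc 1 n, lam i • (X i ω - μ) := by
      refine Finset.stronglyMeasurable_fun_sum _ fun i hi ↦ ?_
      have hXi := measurable_obsSigma X (Finset.mem_Icc.1 hi).1 (Finset.mem_Icc.1 hi).2
      exact (hXi.stronglyMeasurable.sub stronglyMeasurable_const).const_smul (lam i)
    exact Real.continuous_exp.comp_stronglyMeasurable
      ((stronglyMeasurable_const.inner hS).sub stronglyMeasurable_const)
  have hfac (n : ℕ) :=
    h (n + 1) n.succ_pos (lam (n + 1)) (hlam _ n.succ_pos).1 (hlam _ n.succ_pos).2 v hv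
  have hstep (n : ℕ) (hn : Integrable (expProcess X μ ψ lam v n) P) :
      Integrable (expProcess X μ ψ lam v (n + 1)) P := by
    rw [expProcess_succ]
    exact Integrable.mul_of_condExp_le_const ((obsFiltration X hX).le n)
      ((hadp n).const_smul _) (fun ω ↦ mul_nonneg (Real.exp_nonneg _) (Real.exp_nonneg _))
      (hn.smul _) (fun ω ↦ Real.exp_nonneg _) (hfac n).1 (hfac n).2
  have hint (n : ℕ) : Integrable (expProcess X μ ψ lam v n) P := by
    induction n with
    | zero =>
      have h0 : expProcess X μ ψ lam v 0 = fun _ ↦ 1 := by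
        ext ω
        simp [expProcess]
      rw [h0]
      exact integrable_const 1
    | succ n ih => exact hstep n ih
  refine supermartingale_nat hadp hint fun n ↦ ?_
  have hi := hint (n + 1)
  rw [expProcess_succ] at hi ⊢
  filter_upwards [condExp_mul_of_stronglyMeasurable_left ((hadp n).const_smul _) hi (hfac n).1,
    (hfac n).2] with ω h1 h2
  change _ ≤ Real.exp (ψ (lam (n + 1))) at h2
  rw [h1]
  calc (Real.exp (-ψ (lam (n + 1))) * expProcess X μ ψ lam v n ω) * _
      ≤ (Real.exp (-ψ (lam (n + 1))) * expProcess X μ ψ lam v n ω) *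
          Real.exp (ψ (lam (n + 1))) :=
        mul_le_mul_of_nonneg_left h2 (mul_nonneg (Real.exp_nonneg _) (Real.exp_nonneg _))
    _ = expProcess X μ ψ lam v n ω := by
        rw [mul_right_comm, ← Real.exp_add]
        simp

/-- The exponential processes in the directions `±eᵢ` together control the Euclidean norm. -/
theorem exp_norm_sub_le_sum_expProcess {Ω : Type*} {d : ℕ} (hd : 0 < d)
    (X : ℕ → Ω → EuclideanSpace ℝ (Fin d)) (μ : EuclideanSpace ℝ (Fin d)) (ψ : ℝ → ℝ)
    (lam : ℕ → ℝ) (n : ℕ) (ω : Ω) :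
    d * Real.exp (‖∑ i ∈ Finset.Icc 1 n, lam i • (X i ω - μ)‖ / Real.sqrt d
        - ∑ i ∈ Finset.Icc 1 n, ψ (lam i)) ≤
      ∑ j, (expProcess X μ ψ lam (EuclideanSpace.single j 1) n ω
        + expProcess X μ ψ lam (-EuclideanSpace.single j 1) n ω) := by
  have hd' : (0 : ℝ) < d := Nat.cast_pos.2 hd
  have h := EuclideanSpace.exp_norm_div_sqrt_le hd (∑ i ∈ Finset.Icc 1 n, lam i • (X i ω - μ))
  have hrhs : ∑ j, (expProcess X μ ψ lam (EuclideanSpace.single j 1) n ω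
        + expProcess X μ ψ lam (-EuclideanSpace.single j 1) n ω) =
      2 * (∑ j, Real.cosh ((∑ i ∈ Finset.Icc 1 n, lam i • (X i ω - μ)) j)) *
        Real.exp (-∑ i ∈ Finset.Icc 1 n, ψ (lam i)) := by
    rw [Finset.mul_sum, Finset.sum_mul]
    refine Finset.sum_congr rfl fun j _ ↦ ?_
    simp only [expProcess, inner_neg_left, EuclideanSpace.inner_single_left, map_one, one_mul,
      Real.cosh_eq, sub_eq_add_neg, Real.exp_add]
    ring
  rw [hrhs, sub_eq_add_neg, Real.exp_add, ← mul_assoc]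
  refine mul_le_mul_of_nonneg_right ?_ (Real.exp_nonneg _)
  rw [mul_div_assoc', le_div_iff₀ hd'] at h
  linarith

/-- Time-uniform concentration of the weighted sums of a sub-`ψ` sequence. -/
theorem IsSubPsi.le_measureReal_forall_norm_sum_le {Ω : Type*} [MeasurableSpace Ω] {P : Measure Ω}
    [IsProbabilityMeasure P] {d : ℕ} (hd : 0 < d) {X : ℕ → Ω → EuclideanSpace ℝ (Fin d)}
    (hX : ∀ t : ℕ, 1 ≤ t → Measurable (X t)) {μ : EuclideanSpace ℝ (Fin d)} {ψ : ℝ → ℝ}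
    {lmax : EReal} (h : IsSubPsi P X μ ψ lmax) {lam : ℕ → ℝ}
    (hlam : ∀ t : ℕ, 1 ≤ t → 0 ≤ lam t ∧ (lam t : EReal) < lmax) {α : ℝ} (hα : 0 < α) :
    1 - α ≤ P.real {ω | ∀ t : ℕ, ‖∑ i ∈ Finset.Icc 1 t, lam i • (X i ω - μ)‖ ≤
      Real.sqrt d * (∑ i ∈ Finset.Icc 1 t, ψ (lam i) + Real.log 2 + Real.log (1 / α))} := by
  have hd' : (0 : ℝ) < d := Nat.cast_pos.2 hd
  let M : ℕ → Ω → ℝ := ∑ j, (expProcess X μ ψ lam (EuclideanSpace.single j 1)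
    + expProcess X μ ψ lam (-EuclideanSpace.single j 1))
  have hMapply (n : ℕ) (ω : Ω) : M n ω =
      ∑ j, (expProcess X μ ψ lam (EuclideanSpace.single j 1) n ω
        + expProcess X μ ψ lam (-EuclideanSpace.single j 1) n ω) := by
    simp [M]
  have hM : Supermartingale M (obsFiltration X hX) P :=
    Supermartingale.finset_sum _ fun j _ ↦
      (supermartingale_expProcess hX h hlam (by simp)).add
        (supermartingale_expProcess hX h hlam (by simp))
  have hM0 (n : ℕ) (ω : Ω) : 0 ≤ M n ω := by
    rw [hMapply]
    exact Finset.sum_nonneg fun j _ ↦ add_nonneg (Real.exp_nonneg _) (Real.exp_nonneg _)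
  have hinit : ∫ ω, M 0 ω ∂P = 2 * d := by
    simp [hMapply, expProcess]
    ring
  -- The `2 * d` processes all start at `1`, so this level leaves failure probability `α`.
  have hville := hM.ville_inequality hM0 (c := 2 * d / α) (by positivity)
  rw [hinit, div_mul_eq_mul_div, div_le_iff₀ hα] at hville
  have hbad : P.real {ω | ∃ n, 2 * d / α ≤ M n ω} ≤ α :=
    le_of_mul_le_mul_left hville (by positivity)
  -- Subadditivity suffices here and requires no measurability of the event.
  have hcover : 1 ≤ P.real {ω | ∃ n, 2 * d / α ≤ M n ω} +
      P.real {ω | ∃ n, 2 * d / α ≤ M n ω}ᶜ := by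
    rw [← probReal_univ (μ := P), ← Set.union_compl_self {ω | ∃ n, 2 * d / α ≤ M n ω}]
    exact measureReal_union_le _ _
  have hsub : P.real {ω | ∃ n, 2 * d / α ≤ M n ω}ᶜ ≤ P.real {ω | ∀ t : ℕ,
      ‖∑ i ∈ Finset.Icc 1 t, lam i • (X i ω - μ)‖ ≤
      Real.sqrt d * (∑ i ∈ Finset.Icc 1 t, ψ (lam i) + Real.log 2 + Real.log (1 / α))} := by
    refine measureReal_mono fun ω hω t ↦ ?_
    have hlt : M t ω < 2 * d / α := not_le.1 fun hle ↦ hω ⟨t, hle⟩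
    have hexp := (exp_norm_sub_le_sum_expProcess hd X μ ψ lam t ω).trans_lt (hMapply t ω ▸ hlt)
    have hlog : ‖∑ i ∈ Finset.Icc 1 t, lam i • (X i ω - μ)‖ / Real.sqrt d
        - ∑ i ∈ Finset.Icc 1 t, ψ (lam i) ≤ Real.log (2 * (1 / α)) := by
      rw [Real.le_log_iff_exp_le (by positivity)]
      refine le_of_mul_le_mul_left (hexp.le.trans_eq ?_) hd'
      ring
    rw [Real.log_mul two_ne_zero (by positivity)] at hlog
    rw [mul_comm, ← div_le_iff₀ (Real.sqrt_pos.2 hd')]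
    linarith
  linarith

/-- A bound on the conditional moment generating function by a function of the norm of its
argument is the same as the sub-`ψ` condition. -/
theorem forall_condExp_exp_inner_le_iff_isSubPsi {Ω : Type*} [MeasurableSpace Ω] {P : Measure Ω}
    [IsProbabilityMeasure P] {d : ℕ} {X : ℕ → Ω → EuclideanSpace ℝ (Fin d)}
    (hX : ∀ t : ℕ, 1 ≤ t → Measurable (X t)) {μ : EuclideanSpace ℝ (Fin d)} {ψ : ℝ → ℝ}
    (hψ : ψ 0 = 0) {lmax : EReal} :
    (∀ t : ℕ, 1 ≤ t → ∀ u : EuclideanSpace ℝ (Fin d), (‖u‖ : EReal) < lmax →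
      Integrable (fun ω => Real.exp (inner ℝ u (X t ω - μ))) P ∧
      P[fun ω => Real.exp (inner ℝ u (X t ω - μ)) | obsSigma X (t - 1)]
        ≤ᵐ[P] fun _ => Real.exp (ψ ‖u‖)) ↔ IsSubPsi P X μ ψ lmax := by
  constructor
  · intro h t ht l hl hlm v hv
    have hn : ‖l • v‖ = l := by rw [norm_smul, hv, mul_one, Real.norm_of_nonneg hl]
    have := h t ht (l • v) (by rwa [hn])
    simpa only [hn, real_inner_smul_left] using this
  · intro h t ht u hu
    -- The zero vector has no direction; there the bound reads `1 ≤ exp (ψ 0)`, whence `ψ 0 = 0`.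
    rcases eq_or_ne u 0 with rfl | hu0
    · simp only [inner_zero_left, Real.exp_zero, norm_zero, hψ]
      refine ⟨integrable_const 1, ?_⟩
      exact (Filter.EventuallyEq.of_eq
        (condExp_const (μ := P) ((obsFiltration X hX).le (t - 1)) (1 : ℝ))).le
    · have hn : ‖u‖ ≠ 0 := norm_ne_zero_iff.2 hu0
      have := h t ht ‖u‖ (norm_nonneg u) hu (‖u‖⁻¹ • u)
        (by rw [norm_smul, norm_inv, norm_norm, inv_mul_cancel₀ hn])
      simpa only [← real_inner_smul_left, smul_smul, mul_inv_cancel₀ hn, one_smul] using this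

theorem mainTheorem3 {Ω : Type*} [MeasurableSpace Ω] (P : Measure Ω) [IsProbabilityMeasure P]
    {d : ℕ} (hd : 2 ≤ d) (X : ℕ → Ω → EuclideanSpace ℝ (Fin d))
    (hX : ∀ t : ℕ, 1 ≤ t → Measurable (X t))
    (μ : EuclideanSpace ℝ (Fin d)) (hμ : HasConstCondMean P X μ) :
    (∀ (ψ : ℝ → ℝ) (lmax : EReal), IsSubPsi P X μ ψ lmax →
      ∀ lam : ℕ → ℝ, (∀ t : ℕ, 1 ≤ t → 0 ≤ lam t ∧ (lam t : EReal) < lmax) →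
      ∀ α : ℝ, 0 < α → α < 1 →
        1 - α ≤ P.real {ω | ∀ t : ℕ, 1 ≤ t → 0 < ∑ i ∈ Finset.Icc 1 t, lam i →
          ‖(∑ i ∈ Finset.Icc 1 t, lam i)⁻¹ • (∑ i ∈ Finset.Icc 1 t, lam i • X i ω) - μ‖ ≤
            (Real.sqrt d * ∑ i ∈ Finset.Icc 1 t, ψ (lam i) + 2 * Real.sqrt d
                + Real.sqrt d * Real.log (1 / α)) /
              (2 / 3 * ∑ i ∈ Finset.Icc 1 t, lam i)}) ∧
    (∀ σ : ℝ, IsCondSubGaussian P X μ σ ↔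
      IsSubPsi P X μ (fun l => l ^ 2 * σ ^ 2 / 2) ⊤) ∧
    (∀ (σ : ℝ) (lmax : EReal), IsCondSubExponential P X μ σ lmax ↔
      IsSubPsi P X μ (fun l => l ^ 2 * σ ^ 2 / 2) lmax) ∧
    (∀ b : ℝ, 0 < b → (IsCondSubGamma P X μ b ↔
      IsSubPsi P X μ (fun l => l ^ 2 / (2 * (1 - b * l))) ((1 / b : ℝ) : EReal))) := by
  refine ⟨fun ψ lmax h lam hlam α hα _ ↦ ?_, fun σ ↦ ?_, fun σ lmax ↦ ?_, fun b _ ↦ ?_⟩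
  · refine (h.le_measureReal_forall_norm_sum_le (by omega) hX hlam hα).trans
      (measureReal_mono fun ω hω t _ hpos ↦ ?_)
    have hsum : ∑ i ∈ Finset.Icc 1 t, lam i • (X i ω - μ) = (∑ i ∈ Finset.Icc 1 t, lam i) •
        ((∑ i ∈ Finset.Icc 1 t, lam i)⁻¹ • (∑ i ∈ Finset.Icc 1 t, lam i • X i ω) - μ) := by
      rw [smul_sub, smul_inv_smul₀ hpos.ne']
      simp_rw [smul_sub, Finset.sum_sub_distrib, Finset.sum_smul]
    have ht := hω t
    rw [hsum, norm_smul, Real.norm_of_nonneg hpos.le] at ht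
    rw [le_div_iff₀ (by positivity)]
    -- The stated constants have slack: `log 2 ≤ 2` here, and `2 / 3 ≤ 1` through `hnn`.
    have hlog : Real.sqrt d * Real.log 2 ≤ Real.sqrt d * 2 :=
      mul_le_mul_of_nonneg_left (Real.log_two_lt_d9.le.trans (by norm_num)) (Real.sqrt_nonneg _)
    have hnn := mul_nonneg hpos.le (norm_nonneg
      ((∑ i ∈ Finset.Icc 1 t, lam i)⁻¹ • (∑ i ∈ Finset.Icc 1 t, lam i • X i ω) - μ))
    linarith
  · rw [← forall_condExp_exp_inner_le_iff_isSubPsi hX (by simp)]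
    simp only [IsCondSubGaussian, EReal.coe_lt_top, forall_true_left]
  · exact forall_condExp_exp_inner_le_iff_isSubPsi (ψ := fun l ↦ l ^ 2 * σ ^ 2 / 2) hX (by simp)
  · rw [← forall_condExp_exp_inner_le_iff_isSubPsi hX (by simp)]
    simp only [IsCondSubGamma, EReal.coe_lt_coe_iff]
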